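/- Let $T$ be a complete first-order theory with infinite models, in a language $L$, and write $|T|=|L|+\aleph_0$. Suppose that $T$ is NIP: for no $L$-formula $\varphi(x,y)$ ($x,y$ finite tuples of variables) are there, in a model of $T$, tuples $(a_t)_{t\in\omega}$ and $(b_s)_{s\subseteq\omega}$ such that $\varphi(a_t,b_s)$ holds if and only if $t\in s$. Then for every cardinal $\kappa\geq|T|$ there is a model $M$ of $T$ with $|M|=\kappa$ such that $$|S(A)|\leq|A|^{|T|}\quad\text{for every } A\subseteq M \text{ with } |A|\geq 2,$$ where $S(A)=\bigcup_{n<\omega}S_n(A)$ is the set of complete finitary types over $A$. Moreover, $M$ can be chosen to be the Skolem hull of an indiscernible sequence: there are a Skolemization $T'\supseteq T$ in a language $L'\supseteq L$ with $|L'|\leq|T|$ (every model of $T$ expands to a model of $T'$, and for every $L'$-formula $\varphi(x,y)$, with $x$ a finite tuple and $y$ a single variable, there is an $L'$-term $t(x)$ with $T'\models\forall x\,(\exists y\,\varphi(x,y)\to\varphi(x,t(x)))$), an expansion of $M$ to a model of $T'$, and an $L'$-indiscernible sequence $(a_\alpha)_{\alpha<\kappa}$ of distinct elements of $M$ that generates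 $M$ under the functions of $L'$. -/

import Mathlib

universe u v w

open FirstOrder

namespace NIPFewTypes

open FirstOrder.Language Cardinal

variable {L : FirstOrder.Language.{u, v}}

/-- `|T|`: the cardinality of the language of `T` plus `ℵ₀` (the number of `L`-formulas). -/
noncomputable def theoryCard (_T : L.Theory) : Cardinal.{max u v} :=
  max ℵ₀ L.card

/-- `φ(x, y)` is NIP modulo `T`: in no model of `T` are there tuples `(a_t)` for `t ∈ ω` and
`(b_s)` for `s ⊆ ω` with `φ(a_t, b_s) ↔ t ∈ s`. A model containing such a pattern has an
elementary substructure of size at most `|T| + 2 ^ ℵ₀` containing it, so it is enough to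
look at models in the universe `max u v`. -/
def FormulaNIP (T : L.Theory) {m n : ℕ} (φ : L.Formula (Fin m ⊕ Fin n)) : Prop :=
  ∀ N : Theory.ModelType.{u, v, max u v} T,
    ¬ ∃ (a : ℕ → Fin m → N) (b : Set ℕ → Fin n → N),
      ∀ (t : ℕ) (s : Set ℕ), φ.Realize (Sum.elim (a t) (b s)) ↔ t ∈ s

/-- `T` is NIP: every partitioned formula is NIP modulo `T`. -/
def TheoryNIP (T : L.Theory) : Prop :=
  ∀ (m n : ℕ) (φ : L.Formula (Fin m ⊕ Fin n)), FormulaNIP T φ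

/-- `S_n(A)`: complete `n`-types over a parameter set `A ⊆ M`, that is, complete `n`-types of the
`L(A)`-theory of `M`. -/
abbrev TypesOver (L : FirstOrder.Language.{u, v}) {M : Type w} [L.Structure M] [Nonempty M] (A : Set M)
    (n : ℕ) :=
  Theory.CompleteType (L[[A]].completeTheory M) (Fin n)

/-- `S(A)`: complete finitary types over `A`. -/
abbrev AllTypesOver (L : FirstOrder.Language.{u, v}) {M : Type w} [L.Structure M] [Nonempty M] (A : Set M) :=
  Σ n : ℕ, TypesOver L A n

/-- The sequence `(a_i)_{i ∈ J}` of elements of `M` is indiscernible (over `∅`, for `L`-formulas). -/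
def Indiscernible (L : FirstOrder.Language.{u, v}) {M : Type*} [L.Structure M] {J : Type*} [LinearOrder J]
    (a : J → M) : Prop :=
  ∀ (n : ℕ) (φ : L.Formula (Fin n)) (i j : Fin n → J), StrictMono i → StrictMono j →
    (φ.Realize (a ∘ i) ↔ φ.Realize (a ∘ j))

/-- `T'` (in the language `L'`, which extends `L` along `ι`) is a Skolemization of `T`. Models are
taken in `Type w`; it is used with a `w` large enough for this to be no restriction. -/
structure IsSkolemization {L' : FirstOrder.Language.{max u v, v}} (ι : L →ᴸ L') (T : L.Theory)
    (T' : L'.Theory) : Prop where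
  injective : ι.Injective
  card_le : L'.card ≤ theoryCard T
  extends_theory : ι.onTheory T ⊆ T'
  /-- Every model of `T` expands to a model of `T'`. -/
  expands : ∀ N : Theory.ModelType.{u, v, w} T,
    ∃ _ : L'.Structure N, ι.IsExpansionOn N ∧ (N : Type w) ⊨ T'
  /-- For every `φ(x, y)` there is a term `t(x)` with `T' ⊨ ∀ x (∃ y φ(x, y) → φ(x, t(x)))`. -/
  skolem : ∀ (n : ℕ) (φ : L'.Formula (Fin (n + 1))), ∃ t : L'.Term (Fin n),
    ∀ (N : Theory.ModelType.{max u v, v, w} T') (x : Fin n → N) (y : N),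
      φ.Realize (Fin.snoc x y : Fin (n + 1) → N) →
        φ.Realize (Fin.snoc x (t.realize x) : Fin (n + 1) → N)

/-- `M` is the Skolem hull of an indiscernible sequence of `κ` distinct elements: for some
Skolemization `T'` of `T`, `M` expands to a model of `T'` that is generated, under the functions of
the language of `T'`, by an `L'`-indiscernible sequence indexed by the ordinal `κ`. -/
def IsSkolemHullOfIndiscernible (T : L.Theory) (M : Theory.ModelType.{u, v, w} T)
    (κ : Cardinal.{w}) : Prop :=
  ∃ (L' : FirstOrder.Language.{max u v, v}) (ι : L →ᴸ L') (T' : L'.Theory),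
    IsSkolemization.{u, v, w} ι T T' ∧
    ∃ _ : L'.Structure M, ι.IsExpansionOn M ∧ (M : Type w) ⊨ T' ∧
      ∃ a : κ.ord.ToType → M, Function.Injective a ∧ Indiscernible L' a ∧
        Substructure.closure L' (Set.range a) = ⊤

end NIPFewTypes

/-!
The model `M` is the Skolem hull of an indiscernible sequence `(a_i)` indexed by the ordinal `κ`;
the finite tuples of the sequence satisfy exactly the formulas that hold almost everywhere for the
powers of a nonprincipal ultrafilter on an infinite model. Let `A ⊆ M`. Then `A` lies in the hull
of `(a_i)` for `i` in a set `I` with `|I| ≤ |A| + ℵ₀`. A type over `A` is finitely satisfiable in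
`M`, so it is given by an ultrafilter. Each `L(A)`-formula is equivalent to some `χ(a_i, y)`, where
`i` is an increasing tuple from `I` and `χ` arises by substituting Skolem terms into an `L`-formula,
so that `χ` has finite VC dimension.

Let `S` be the set of increasing tuples `i` with `χ(a_i, y)` in a given type. Membership in `S` is
determined by the position of `i` relative to some finite subset of `I`. Otherwise, as `I` is
well-ordered, there are infinitely many pairs of tuples, one in `S` and one not, such that the two
tuples of each pair differ in a single entry and these entries sweep out disjoint intervals. Among
them there are arbitrarily many pairs such that the choice of one tuple from each never affects the
order pattern. By indiscernibility the corresponding points `a_i` are then shattered by `χ`, a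
contradiction. So there are at most `|I| + ℵ₀` possibilities for `S`, and a type in `n` variables is
determined by the sets `S` for the at most `|T|` formulas `χ`.
-/

namespace NIPFewTypes

universe u' v' w'

open FirstOrder.Language Cardinal

section IndependentSets

variable {V : Type*} {R : V → V → Prop} {k : ℕ} {s : Finset V}

theorem exists_card_filter_le_of_outdegree_le [DecidableRel R]
    (hdeg : ∀ i ∈ s, (s.filter (R i)).card ≤ k) (hs : s.Nonempty) :
    ∃ j ∈ s, (s.filter (R · j)).card ≤ k := by
  apply Finset.exists_le_of_sum_le hs
  calc ∑ j ∈ s, (s.filter (R · j)).card = ∑ i ∈ s, (s.filter (R i)).card :=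
        (Finset.sum_card_bipartiteAbove_eq_sum_card_bipartiteBelow R).symm
    _ ≤ ∑ _i ∈ s, k := Finset.sum_le_sum hdeg

theorem exists_independent_of_outdegree_le [DecidableRel R]
    (hdeg : ∀ i ∈ s, (s.filter (R i)).card ≤ k) {N : ℕ} (hs : N * (2 * k + 1) ≤ s.card) :
    ∃ t ⊆ s, t.card = N ∧ (t : Set V).Pairwise fun i j => ¬ R i j := by
  classical
  induction N generalizing s with
  | zero => exact ⟨∅, by simp⟩
  | succ N ih =>
    obtain ⟨j, hj, hjk⟩ := exists_card_filter_le_of_outdegree_le hdeg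
      (Finset.card_pos.1 (by nlinarith))
    let s' := s.filter fun i => i ≠ j ∧ ¬ R i j ∧ ¬ R j i
    have hss : s' ⊆ s := Finset.filter_subset _ _
    have hcard : s.card ≤ s'.card + (1 + (k + k)) := by
      have hcover : s ⊆ s' ∪ ({j} ∪ (s.filter (R · j) ∪ s.filter (R j))) := by
        intro i hi
        simp only [s', Finset.mem_union, Finset.mem_filter, Finset.mem_singleton]
        tauto
      calc s.card ≤ (s' ∪ ({j} ∪ (s.filter (R · j) ∪ s.filter (R j)))).card :=
            Finset.card_le_card hcover
        _ ≤ s'.card + (({j} : Finset V).card +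
              ((s.filter (R · j)).card + (s.filter (R j)).card)) := by
            refine (Finset.card_union_le _ _).trans ?_
            gcongr
            refine (Finset.card_union_le _ _).trans ?_
            gcongr
            exact Finset.card_union_le _ _
        _ ≤ s'.card + (1 + (k + k)) := by
            gcongr
            exacts [(Finset.card_singleton j).le, hdeg j hj]
    obtain ⟨t, hts, htN, ht⟩ := ih
      (fun i hi => (Finset.card_le_card (Finset.filter_subset_filter _ hss)).trans
        (hdeg i (hss hi))) (by linarith)
    have hsep : ∀ i ∈ t, i ≠ j ∧ ¬ R i j ∧ ¬ R j i := fun i hi => (Finset.mem_filter.1 (hts hi)).2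
    have hjt : j ∉ t := fun h => (hsep j h).1 rfl
    refine ⟨insert j t, Finset.insert_subset hj (hts.trans hss),
      by rw [Finset.card_insert_of_notMem hjt, htN], ?_⟩
    rw [Finset.coe_insert]
    exact ht.insert fun i hi _ => ⟨(hsep i hi).2.2, (hsep i hi).2.1⟩

end IndependentSets

theorem exists_finset_piercing_or_exists_seq {I β : Type*} [LinearOrder I] [WellFoundedLT I]
    (lo hi : β → I) :
    (∃ D : Finset I, ∀ x, ∃ d ∈ D, d ∈ Set.Icc (lo x) (hi x)) ∨
      ∃ c : ℕ → β, ∀ i j, i < j → hi (c i) < lo (c j) := by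
  classical
  by_contra! h
  obtain ⟨hpierce, hseq⟩ := h
  let unpierced (D : Finset I) : Set β := {x | ∀ d ∈ D, d ∉ Set.Icc (lo x) (hi x)}
  let P (x : β) : Prop := ∃ D, x ∈ unpierced D ∧ ∀ y ∈ unpierced D, hi x ≤ hi y
  obtain ⟨c, -, hc⟩ := exists_seq_of_forall_finset_exists P (fun x y => hi x < lo y) (by
    intro s hs
    choose! D _ hmin using hs
    let E : Finset I := s.biUnion D ∪ s.image hi
    let y := Function.argminOn hi (unpierced E) (hpierce E)
    have hy : y ∈ unpierced E := Function.argminOn_mem hi _ _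
    refine ⟨y, ⟨E, hy, fun z hz => Function.argminOn_le hi _ hz⟩, fun x hx => ?_⟩
    have hxy : hi x ≤ hi y := hmin x hx y fun d hd =>
      hy d (Finset.mem_union_left _ (Finset.mem_biUnion.2 ⟨x, hx, hd⟩))
    exact not_le.1 fun h =>
      hy (hi x) (Finset.mem_union_right _ (Finset.mem_image_of_mem hi hx)) ⟨h, hxy⟩)
  obtain ⟨i, j, hij, hle⟩ := hseq c
  exact (hc i j hij).not_ge hle

theorem lt_iff_lt_of_disjoint_ordConnected {I : Type*} [LinearOrder I] {C D : Set I}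
    (hC : C.OrdConnected) (hD : D.OrdConnected) (hCD : Disjoint C D) {p p' q q' : I}
    (hp : p ∈ C) (hp' : p' ∈ C) (hq : q ∈ D) (hq' : q' ∈ D) : p < q ↔ p' < q' := by
  suffices H : ∀ {p p' q q' : I}, p ∈ C → p' ∈ C → q ∈ D → q' ∈ D → p < q → p' < q' from
    ⟨H hp hp' hq hq', H hp' hp hq' hq⟩
  intro p p' q q' hp hp' hq hq' hpq
  by_contra! hle
  rcases le_total p q' with h | h
  · exact hCD.notMem_of_mem_left (hC.out hp hp' ⟨h, hle⟩) hq'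
  · exact hCD.notMem_of_mem_left hp (hD.out hq' hq ⟨h, hpq.le⟩)

section CutDetermined

variable {I : Type*} [LinearOrder I] {k : ℕ}

/-- The positions of the entries of `u` relative to the elements of `D`. -/
def cutType (D : Finset I) (u : Fin k ↪o I) : Fin k → D → Ordering :=
  fun l d => cmp (u l) d

/-- Membership of an increasing tuple in `S` depends only on its position relative to some finite
set of cuts. Increasing `k`-tuples are encoded as order embeddings `Fin k ↪o I`. -/
def IsCutDetermined (S : Set (Fin k ↪o I)) : Prop :=
  ∃ D : Finset I, ∀ u v, cutType D u = cutType D v → (u ∈ S ↔ v ∈ S)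

/-- The pairs `u i true`, `u i false` of increasing tuples witness that `S` cuts out every subset
of `N` points in an order-homogeneous way: `S` separates the two members of each pair, while the
order type of a choice of one member from each pair does not depend on the choice. -/
def IsOrderPattern (S : Set (Fin k ↪o I)) {N : ℕ} (u : Fin N → Bool → Fin k ↪o I) : Prop :=
  (∀ i b, u i b ∈ S ↔ b = true) ∧
    ∀ (W W' : Fin N → Bool) (i j : Fin N) (l l' : Fin k),
      u i (W i) l < u j (W j) l' ↔ u i (W' i) l < u j (W' j) l'

/-- Two increasing tuples that agree except possibly at one position, and of which exactly one lies
in `S`: the one labelled `true`. -/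
structure Flip (S : Set (Fin k ↪o I)) where
  tuple : Bool → Fin k ↪o I
  pos : Fin k
  tuple_eq : ∀ l, l ≠ pos → ∀ b b', tuple b l = tuple b' l
  mem_iff : ∀ b, tuple b ∈ S ↔ b = true

namespace Flip

variable {S : Set (Fin k ↪o I)}

/-- The interval swept out by the entry at which the two tuples of a flip differ. -/
def gap (x : Flip S) : Set I :=
  Set.uIcc (x.tuple true x.pos) (x.tuple false x.pos)

theorem tuple_pos_mem_gap (x : Flip S) (b : Bool) : x.tuple b x.pos ∈ x.gap := by
  cases b
  exacts [Set.right_mem_uIcc, Set.left_mem_uIcc]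

theorem lt_iff_lt_of_independent {x y : Flip S} (hgap : Disjoint x.gap y.gap)
    (hxy : ∀ l, x.tuple true l ∉ y.gap) (hyx : ∀ l, y.tuple true l ∉ x.gap) (b b' c c' : Bool)
    (l l' : Fin k) : x.tuple b l < y.tuple c l' ↔ x.tuple b' l < y.tuple c' l' := by
  by_cases hl : l = x.pos <;> by_cases hl' : l' = y.pos
  · subst hl hl'
    exact lt_iff_lt_of_disjoint_ordConnected Set.ordConnected_uIcc Set.ordConnected_uIcc hgap
      (x.tuple_pos_mem_gap b) (x.tuple_pos_mem_gap b') (y.tuple_pos_mem_gap c)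
      (y.tuple_pos_mem_gap c')
  · subst hl
    rw [y.tuple_eq l' hl' c true, y.tuple_eq l' hl' c' true]
    exact lt_iff_lt_of_disjoint_ordConnected Set.ordConnected_uIcc Set.ordConnected_singleton
      (Set.disjoint_singleton_right.2 (hyx l')) (x.tuple_pos_mem_gap b) (x.tuple_pos_mem_gap b')
      rfl rfl
  · subst hl'
    rw [x.tuple_eq l hl b true, x.tuple_eq l hl b' true]
    exact lt_iff_lt_of_disjoint_ordConnected Set.ordConnected_singleton Set.ordConnected_uIcc
      (Set.disjoint_singleton_left.2 (hxy l)) rfl rfl (y.tuple_pos_mem_gap c)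
      (y.tuple_pos_mem_gap c')
  · rw [x.tuple_eq l hl b b', y.tuple_eq l' hl' c c']

theorem isOrderPattern_of_independent {N : ℕ} {x : Fin N → Flip S}
    (hgap : Pairwise fun i j => Disjoint (x i).gap (x j).gap)
    (hind : ∀ i j, i ≠ j → ∀ l, (x i).tuple true l ∉ (x j).gap) :
    IsOrderPattern S fun i => (x i).tuple := by
  refine ⟨fun i => (x i).mem_iff, fun W W' i j l l' => ?_⟩
  rcases eq_or_ne i j with rfl | hij
  · rw [OrderEmbedding.lt_iff_lt, OrderEmbedding.lt_iff_lt]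
  · exact lt_iff_lt_of_independent (hgap hij) (hind i j hij) (hind j i hij.symm) _ _ _ _ l l'

/-- As the gaps are disjoint, a tuple of length `k` meets at most `k` of them. So in the digraph
with an edge from `i` to `j` when `(x i).tuple true` meets `(x j).gap`, out-degrees are at most
`k`. -/
theorem exists_isOrderPattern_of_disjoint {x : ℕ → Flip S}
    (hgap : Pairwise fun i j => Disjoint (x i).gap (x j).gap) (N : ℕ) :
    ∃ u : Fin N → Bool → Fin k ↪o I, IsOrderPattern S u := by
  classical
  let R (i j : ℕ) : Prop := ∃ l, (x i).tuple true l ∈ (x j).gap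
  let s := Finset.range (N * (2 * k + 1))
  have hdeg : ∀ i ∈ s, (s.filter (R i)).card ≤ k := by
    intro i _
    choose g hg using fun j : s.filter (R i) => (Finset.mem_filter.1 j.2).2
    have hinj : Function.Injective g := fun j j' hjj' => Subtype.ext <| by_contra fun hne =>
      (hgap hne).notMem_of_mem_left (hg j) (hjj' ▸ hg j')
    simpa only [Fintype.card_coe, Fintype.card_fin] using Fintype.card_le_of_injective g hinj
  obtain ⟨t, -, htN, ht⟩ :=
    exists_independent_of_outdegree_le hdeg (Finset.card_range _).ge
  let e := t.orderEmbOfFin htN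
  exact ⟨_, isOrderPattern_of_independent (x := x ∘ e)
    (fun i j hij => hgap (e.injective.ne hij)) fun i j hij l hl =>
      ht (t.orderEmbOfFin_mem htN i) (t.orderEmbOfFin_mem htN j) (e.injective.ne hij) ⟨l, hl⟩⟩

end Flip

theorem strictMono_update_of_last_ne {u v : Fin k ↪o I} {l : Fin k} (hlt : u l < v l)
    (hlast : ∀ l', l < l' → u l' = v l') : StrictMono (Function.update u l (v l)) := by
  intro i j hij
  rcases eq_or_ne i l with rfl | hi
  · rw [Function.update_self, Function.update_of_ne hij.ne', hlast j hij]
    exact v.strictMono hij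
  · rw [Function.update_of_ne hi]
    rcases eq_or_ne j l with rfl | hj
    · rw [Function.update_self]
      exact (u.strictMono hij).trans hlt
    · rw [Function.update_of_ne hj]
      exact u.strictMono hij

theorem notMem_uIcc_of_cmp_eq {p q d : I} (h : cmp p d = cmp q d) (hpq : p ≠ q) :
    d ∉ Set.uIcc p q := by
  wlog hlt : p < q generalizing p q
  · rw [Set.uIcc_comm]
    exact this h.symm hpq.symm (hpq.lt_or_gt.resolve_left hlt)
  rw [Set.uIcc_of_lt hlt]
  rintro ⟨hpd, hdq⟩
  rcases hpd.eq_or_lt with rfl | hpd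
  · rw [cmp_self_eq_eq, eq_comm, cmp_eq_eq_iff] at h
    exact hpq h.symm
  · rw [(cmp_eq_lt_iff _ _).2 hpd, eq_comm, cmp_eq_lt_iff] at h
    exact h.not_ge hdq

theorem mem_iff_of_eq_off {S : Set (Fin k ↪o I)} {D : Finset I}
    (hD : ∀ x : Flip S, ∃ d ∈ D, d ∈ x.gap) {u v : Fin k ↪o I} (hcut : cutType D u = cutType D v)
    {l : Fin k} (hoff : ∀ l', l' ≠ l → u l' = v l') : u ∈ S ↔ v ∈ S := by
  wlog huS : u ∈ S generalizing u v
  · by_cases hvS : v ∈ S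
    · exact (this hcut.symm (fun l' h => (hoff l' h).symm) hvS).symm
    · exact iff_of_false huS hvS
  refine iff_of_true huS ?_
  by_contra hvS
  have hne : u l ≠ v l := fun h => hvS <| by
    rwa [← show u = v from DFunLike.ext _ _ fun l' => (eq_or_ne l' l).elim (· ▸ h) (hoff l')]
  let x : Flip S :=
    { tuple := fun b => if b then u else v
      pos := l
      tuple_eq := by
        rintro l' hl' (_ | _) (_ | _) <;> simp [hoff l' hl']
      mem_iff := by
        rintro (_ | _) <;> simpa }
  obtain ⟨d, hd, hgap⟩ := hD x
  exact notMem_uIcc_of_cmp_eq (congrFun (congrFun hcut l) ⟨d, hd⟩) hne hgap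

theorem exists_last_ne {u v : Fin k ↪o I} (huv : u ≠ v) :
    ∃ l, u l ≠ v l ∧ ∀ l', l < l' → u l' = v l' := by
  obtain ⟨l, hl⟩ := DFunLike.ne_iff.1 huv
  obtain ⟨m, hm⟩ := {l | u l ≠ v l}.toFinite.exists_maximal ⟨l, hl⟩
  exact ⟨m, hm.prop, fun l' hl' => by_contra fun h => hm.not_gt h hl'⟩

/-- At the last position where two tuples with the same cut type differ, the smaller entry can be
raised to the larger one. Repeating this joins the two tuples. -/
theorem mem_iff_of_cutType_eq {S : Set (Fin k ↪o I)} {D : Finset I}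
    (hD : ∀ x : Flip S, ∃ d ∈ D, d ∈ x.gap) {u v : Fin k ↪o I}
    (hcut : cutType D u = cutType D v) : u ∈ S ↔ v ∈ S := by
  induction hn : hammingDist u v using Nat.strong_induction_on generalizing u v with
  | _ n ih =>
  rcases eq_or_ne u v with rfl | huv
  · rfl
  obtain ⟨l, hl, hlast⟩ := exists_last_ne huv
  wlog hlt : u l < v l generalizing u v
  · exact (this hcut.symm (by rw [hammingDist_comm, hn]) huv.symm hl.symm
      (fun l' h => (hlast l' h).symm) (hl.lt_or_gt.resolve_left hlt)).symm
  let w : Fin k ↪o I := OrderEmbedding.ofStrictMono _ (strictMono_update_of_last_ne hlt hlast)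
  have hwl : w l = v l := Function.update_self ..
  have hw : ∀ l', l' ≠ l → w l' = u l' := fun l' h => Function.update_of_ne h ..
  have hwcut : cutType D w = cutType D v := by
    funext l' d
    rcases eq_or_ne l' l with rfl | h
    · simp only [cutType, hwl]
    · simpa only [cutType, hw l' h] using congrFun (congrFun hcut l') d
  have hdist : hammingDist w v < n := by
    rw [← hn]
    refine Finset.card_lt_card ((Finset.ssubset_iff_of_subset fun l' => ?_).2 ⟨l, ?_, ?_⟩)
    · rcases eq_or_ne l' l with rfl | h <;> simp [*]
    · simpa using hl
    · simp [hwl]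
  exact (mem_iff_of_eq_off hD (hcut.trans hwcut.symm) fun l' h => (hw l' h).symm).trans
    (ih _ hdist hwcut rfl)

theorem isCutDetermined_of_no_orderPattern [WellFoundedLT I] {S : Set (Fin k ↪o I)} {N : ℕ}
    (hN : ∀ u : Fin N → Bool → Fin k ↪o I, ¬ IsOrderPattern S u) : IsCutDetermined S := by
  rcases exists_finset_piercing_or_exists_seq
    (fun x : Flip S => x.tuple true x.pos ⊓ x.tuple false x.pos)
    (fun x : Flip S => x.tuple true x.pos ⊔ x.tuple false x.pos) with ⟨D, hD⟩ | ⟨c, hc⟩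
  · exact ⟨D, fun _ _ => mem_iff_of_cutType_eq hD⟩
  · have hlt : ∀ i j, i < j → Disjoint (c i).gap (c j).gap := fun i j hij =>
      Set.disjoint_left.2 fun _ hi hj => ((hi.2.trans_lt (hc i j hij)).trans_le hj.1).false
    obtain ⟨u, hu⟩ := Flip.exists_isOrderPattern_of_disjoint (x := c)
      (fun i j hij => hij.lt_or_gt.elim (hlt i j) fun h => (hlt j i h).symm) N
    exact absurd hu (hN u)

theorem mk_isCutDetermined_le :
    #{S : Set (Fin k ↪o I) // IsCutDetermined S} ≤ max ℵ₀ #I := by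
  have hD : #(Finset I) ≤ max ℵ₀ #I := by
    rcases finite_or_infinite I with _ | _
    · exact mk_le_aleph0.trans (le_max_left _ _)
    · exact (mk_finset_of_infinite I).le.trans (le_max_right _ _)
  let f (x : Σ D : Finset I, Set (Fin k → D → Ordering)) : Set (Fin k ↪o I) := cutType x.1 ⁻¹' x.2
  calc #{S : Set (Fin k ↪o I) // IsCutDetermined S}
      ≤ #(Set.range f) := mk_le_mk_of_subset fun S ⟨D, hD⟩ =>
        ⟨⟨D, cutType D '' S⟩, Set.ext fun u =>
          ⟨fun ⟨v, hv, h⟩ => (hD v u h).1 hv, fun hu => ⟨u, hu, rfl⟩⟩⟩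
    _ ≤ #(Σ D : Finset I, Set (Fin k → D → Ordering)) := mk_range_le
    _ = sum fun D : Finset I => #(Set (Fin k → D → Ordering)) := mk_sigma _
    _ ≤ sum fun _ : Finset I => ℵ₀ := sum_le_sum _ _ fun D => mk_le_aleph0
    _ = #(Finset I) * ℵ₀ := sum_const' _ _
    _ ≤ max ℵ₀ #I := mul_le_of_le (le_max_left _ _) hD (le_max_left _ _)

end CutDetermined
section Compactness

variable {L : FirstOrder.Language.{u, v}} {T : L.Theory} {α : Type w'}

theorem exists_realize_of_finitely_realized {β : Type*} (γ : β → L.Formula α)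
    (h : ∀ G : Finset β, ∃ (M : Theory.ModelType.{u, v, w} T) (x : α → M),
      ∀ i ∈ G, (γ i).Realize x) :
    ∃ (K : Theory.ModelType.{u, v, max u v w'} T) (x : α → K), ∀ i, (γ i).Realize x := by
  let S (G : Finset β) : L[[α]].Theory :=
    (L.lhomWithConstants α).onTheory T ∪ (fun i => (γ i).equivSentence) '' G
  have hmono : Monotone S := fun G G' hG =>
    Set.union_subset_union_right _ (Set.image_mono (Finset.coe_subset.2 hG))
  have hS : Theory.IsSatisfiable (⋃ G, S G) := by
    refine (Theory.isSatisfiable_directed_union_iff hmono.directed_le).2 fun G => ?_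
    obtain ⟨M, x, hx⟩ := h G
    let _ : (constantsOn α).Structure M := constantsOn.structure x
    have hT : M ⊨ (L.lhomWithConstants α).onTheory T :=
      (LHom.onTheory_model _ _).2 inferInstance
    have hγ : M ⊨ (fun i => (γ i).equivSentence) '' (G : Set β) :=
      ⟨Set.forall_mem_image.2 fun i hi => (Formula.realize_equivSentence M _).2 (hx i hi)⟩
    have : M ⊨ S G := Theory.model_union_iff.2 ⟨hT, hγ⟩
    exact Theory.Model.isSatisfiable M
  obtain ⟨K⟩ := hS
  have hK (G : Finset β) : K ⊨ S G := K.is_model.mono (Set.subset_iUnion S G)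
  let _ : L.Structure K := (L.lhomWithConstants α).reduct K
  have : (L.lhomWithConstants α).IsExpansionOn K := LHom.isExpansionOn_reduct _ _
  have : K ⊨ T := (LHom.onTheory_model _ _).1 ((hK ∅).mono Set.subset_union_left)
  exact ⟨Theory.ModelType.of T K, fun a => ((L.con a : L[[α]].Constants) : K), fun i =>
    (Formula.realize_equivSentence K (γ i)).1
      ((hK {i}).realize_of_mem _ (Or.inr ⟨i, Finset.mem_singleton_self i, rfl⟩))⟩

end Compactness

section VCDimension

variable {L : FirstOrder.Language.{u, v}} {M : Type*} [L.Structure M] {α β : Type*}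

/-- `φ(x, y)` shatters the points `a i`: every set of them is cut out by some instance
`φ(x, b)`. -/
def Shatters (φ : L.Formula (α ⊕ β)) {ι : Type*} (a : ι → α → M) : Prop :=
  ∀ s : Set ι, ∃ b : β → M, ∀ i, φ.Realize (Sum.elim (a i) b) ↔ i ∈ s

/-- `φ(x, y)` has finite Vapnik–Chervonenkis dimension in `M`, as a family of sets indexed by
`y`. -/
def HasFiniteVCDim (M : Type*) [L.Structure M] (φ : L.Formula (α ⊕ β)) : Prop :=
  ∃ N : ℕ, ∀ a : Fin N → α → M, ¬ Shatters φ a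

theorem realize_ite_not (p : Prop) [Decidable p] (φ : L.Formula α) (x : α → M) :
    (if p then φ else φ.not).Realize x ↔ (φ.Realize x ↔ p) := by
  split_ifs with hp <;> simp [hp, Formula.realize_not]

theorem realize_relabel_map (φ : L.Formula (α ⊕ β)) {γ δ : Type*} (f : α → γ) (g : β → δ)
    (x : γ ⊕ δ → M) : (φ.relabel (Sum.map f g)).Realize x ↔
      φ.Realize (Sum.elim (x ∘ Sum.inl ∘ f) (x ∘ Sum.inr ∘ g)) := by
  rw [Formula.realize_relabel, ← Sum.elim_comp_inl_inr x, Sum.elim_comp_map]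
  rfl

theorem FormulaNIP.hasFiniteVCDim {T : L.Theory} {m n : ℕ} {φ : L.Formula (Fin m ⊕ Fin n)}
    (hφ : FormulaNIP T φ) (M : Type w) [L.Structure M] [Nonempty M] [M ⊨ T] :
    HasFiniteVCDim M φ := by
  classical
  unfold HasFiniteVCDim
  by_contra! hcon
  let γ (p : ℕ × Set ℕ) : L.Formula ((ℕ × Fin m) ⊕ (Set ℕ × Fin n)) :=
    let χ := φ.relabel (Sum.map (Prod.mk p.1) (Prod.mk p.2))
    if p.1 ∈ p.2 then χ else χ.not
  obtain ⟨K, x, hx⟩ := exists_realize_of_finitely_realized (T := T) γ fun G => by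
    obtain ⟨a, ha⟩ := hcon (G.sup Prod.fst + 1)
    choose b hb using fun s : Set ℕ => ha {t | (t : ℕ) ∈ s}
    refine ⟨Theory.ModelType.of T M,
      Sum.elim (fun q => a (Fin.ofNat _ q.1) q.2) (fun q => b q.1 q.2), ?_⟩
    rintro ⟨t, s⟩ hts
    have ht : t % (G.sup Prod.fst + 1) = t :=
      Nat.mod_eq_of_lt (Nat.lt_succ_of_le (Finset.le_sup (f := Prod.fst) hts))
    rw [realize_ite_not, realize_relabel_map]
    exact (hb s (Fin.ofNat _ t)).trans (by rw [Set.mem_ofPred_eq, Fin.val_ofNat, ht])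
  refine hφ K ⟨fun t i => x (Sum.inl (t, i)), fun s j => x (Sum.inr (s, j)), fun t s => ?_⟩
  exact (realize_relabel_map ..).symm.trans ((realize_ite_not ..).1 (hx (t, s)))

end VCDimension
section Trace

variable {L : FirstOrder.Language.{u, v}} {M : Type*} [L.Structure M]

theorem exists_orderEmbedding_comp_surjective {I Q : Type*} [LinearOrder I] [Finite Q]
    (g : Q → I) :
    ∃ (c : ℕ) (e : Fin c ↪o I) (h : Q → Fin c), Function.Surjective h ∧ g = e ∘ h := by
  classical
  have := Fintype.ofFinite Q
  let s : Finset I := Finset.univ.image g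
  let e : Fin s.card ≃o s := s.orderIsoOfFin rfl
  let g' (q : Q) : s := ⟨g q, Finset.mem_image_of_mem g (Finset.mem_univ q)⟩
  have hg' : Function.Surjective g' := fun ⟨i, hi⟩ => by
    obtain ⟨q, -, rfl⟩ := Finset.mem_image.1 hi
    exact ⟨q, rfl⟩
  refine ⟨s.card, s.orderEmbOfFin rfl, e.symm ∘ g', e.symm.surjective.comp hg', funext fun q => ?_⟩
  exact congrArg Subtype.val (e.apply_symm_apply (g' q)).symm

theorem Indiscernible.realize_iff_of_lt_iff_lt {I : Type*} [LinearOrder I] {a : I → M}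
    (ha : Indiscernible L a) {Q : Type*} [Finite Q] (θ : L.Formula Q) {g g' : Q → I}
    (hg : ∀ q q', g q < g q' ↔ g' q < g' q') : θ.Realize (a ∘ g) ↔ θ.Realize (a ∘ g') := by
  obtain ⟨c, e, h, hh, rfl⟩ := exists_orderEmbedding_comp_surjective g
  obtain ⟨r, hr⟩ := hh.hasRightInverse
  have hmono : StrictMono (g' ∘ r) := fun x y hxy => by
    rw [Function.comp_apply, Function.comp_apply, ← hg, Function.comp_apply, hr]
    simpa only [Function.comp_apply, hr y] using e.strictMono hxy
  have hcomp : (g' ∘ r) ∘ h = g' := funext fun q => by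
    have heq : e (h (r (h q))) = e (h q) := by rw [hr]
    exact le_antisymm (not_lt.1 fun hlt => heq.not_gt ((hg _ _).2 hlt))
      (not_lt.1 fun hlt => heq.not_lt ((hg _ _).2 hlt))
  have key := ha c (θ.relabel h) e (g' ∘ r) e.strictMono hmono
  rwa [Formula.realize_relabel, Formula.realize_relabel, Function.comp_assoc, Function.comp_assoc,
    hcomp] at key

variable {k : ℕ} {β : Type*} {I : Type*} [LinearOrder I]

/-- The increasing tuples `i` such that the instance of `χ(x, y)` at `x = a ∘ i` belongs to the
complete type over `M` given by the ultrafilter `U`. -/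
def trace (a : I → M) (U : Ultrafilter (β → M)) (χ : L.Formula (Fin k ⊕ β)) : Set (Fin k ↪o I) :=
  {i | ∀ᶠ y in U, χ.Realize (Sum.elim (a ∘ i) y)}

theorem exists_formula_realize_iff_exists_pattern [Finite β] (χ : L.Formula (Fin k ⊕ β)) {N : ℕ}
    (s : Set (Fin N)) : ∃ θ : L.Formula (Fin N × Fin k), ∀ z : Fin N × Fin k → M,
      θ.Realize z ↔ ∃ y : β → M, ∀ i, χ.Realize (Sum.elim (fun l => z (i, l)) y) ↔ i ∈ s := by
  classical
  let χ' (i : Fin N) : L.Formula ((Fin N × Fin k) ⊕ β) := χ.relabel (Sum.map (Prod.mk i) id)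
  refine ⟨Formula.iExs β (Formula.iInf fun i => if i ∈ s then χ' i else (χ' i).not), fun z => ?_⟩
  simp only [Formula.realize_iExs, Formula.realize_iInf, realize_ite_not]
  refine exists_congr fun y => forall_congr' fun i => ?_
  rw [realize_relabel_map]
  rfl

theorem shatters_of_isOrderPattern_trace [Finite β] {a : I → M} (ha : Indiscernible L a)
    {χ : L.Formula (Fin k ⊕ β)} {U : Ultrafilter (β → M)} {N : ℕ} {u : Fin N → Bool → Fin k ↪o I}
    (hu : IsOrderPattern (trace a U χ) u) : Shatters χ fun i => a ∘ u i true := by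
  classical
  intro s
  obtain ⟨θ, hθ⟩ := exists_formula_realize_iff_exists_pattern (M := M) χ s
  let W (i : Fin N) : Bool := i ∈ s
  have hU : ∀ᶠ y in U, ∀ i, χ.Realize (Sum.elim (a ∘ u i (W i)) y) ↔ i ∈ s := by
    refine Filter.eventually_all.2 fun i => ?_
    by_cases hi : i ∈ s
    · filter_upwards [(hu.1 i (W i)).2 (decide_eq_true hi)] with y hy
      exact iff_of_true hy hi
    · have hmem : u i (W i) ∉ trace a U χ := (hu.1 i (W i)).not.2 (by simpa [W] using hi)
      filter_upwards [Ultrafilter.eventually_not.2 hmem] with y hy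
      exact iff_of_false hy hi
  have hθW : θ.Realize (a ∘ fun q : Fin N × Fin k => u q.1 (W q.1) q.2) := (hθ _).2 hU.exists
  rw [ha.realize_iff_of_lt_iff_lt θ (g' := fun q => u q.1 true q.2)
    fun q q' => hu.2 W (fun _ => true) q.1 q'.1 q.2 q'.2] at hθW
  exact (hθ _).1 hθW

theorem isCutDetermined_trace [WellFoundedLT I] [Finite β] {a : I → M} (ha : Indiscernible L a)
    {χ : L.Formula (Fin k ⊕ β)} (hχ : HasFiniteVCDim M χ) (U : Ultrafilter (β → M)) :
    IsCutDetermined (trace a U χ) := by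
  obtain ⟨N, hN⟩ := hχ
  exact isCutDetermined_of_no_orderPattern fun u hu =>
    hN _ (shatters_of_isOrderPattern_trace ha hu)

end Trace

section Hull

variable {L : FirstOrder.Language.{u, v}} {M : Type w} [L.Structure M]

theorem exists_formula_realize_iff_of_params {A : Set M} {β : Type*} (ψ : L[[A]].Formula β) :
    ∃ (m : ℕ) (p : Fin m → A) (φ : L.Formula (Fin m ⊕ β)),
      ∀ y : β → M, ψ.Realize y ↔ φ.Realize (Sum.elim (fun l => (p l : M)) y) := by
  classical
  let χ : L.Formula (A ⊕ β) := BoundedFormula.constantsVarsEquiv ψ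
  let G := χ.freeVarFinset.toLeft
  let f : χ.freeVarFinset → Fin G.card ⊕ β
    | ⟨Sum.inl c, h⟩ => Sum.inl (G.equivFin ⟨c, Finset.mem_toLeft.2 h⟩)
    | ⟨Sum.inr j, _⟩ => Sum.inr j
  refine ⟨G.card, fun l => G.equivFin.symm l, χ.restrictFreeVar f, fun y => ?_⟩
  have hχ : ψ.Realize y ↔ χ.Realize (Sum.elim (fun c : A => (c : M)) y) :=
    BoundedFormula.realize_constantsVarsEquiv.symm
  refine hχ.trans (BoundedFormula.realize_restrictFreeVar _ ?_).symm
  rintro ⟨c | j, h⟩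
  · simp only [f, Sum.elim_inl, Equiv.symm_apply_apply]
  · rfl

theorem mem_closure_range_iff {I : Type*} {a : I → M} {y : M} :
    y ∈ Substructure.closure L (Set.range a) ↔ ∃ t : L.Term I, t.realize a = y := by
  rw [Substructure.mem_closure_iff_exists_term]
  constructor
  · rintro ⟨t, rfl⟩
    choose g hg using fun z : Set.range a => z.2
    exact ⟨t.relabel g, by rw [Term.realize_relabel, show a ∘ g = (↑) from funext hg]⟩
  · rintro ⟨t, rfl⟩
    exact ⟨t.relabel (Set.rangeFactorization a), Term.realize_relabel ..⟩

theorem exists_terms_of_mem_closure_range {I : Type*} [LinearOrder I] {a : I → M} {G : Type*}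
    [Finite G] {p : G → M} (hp : ∀ l, p l ∈ Substructure.closure L (Set.range a)) :
    ∃ (k : ℕ) (i : Fin k ↪o I) (t : G → L.Term (Fin k)), ∀ l, (t l).realize (a ∘ i) = p l := by
  classical
  choose s hs using fun l => mem_closure_range_iff.1 (hp l)
  obtain ⟨k, i, h, -, hi⟩ := exists_orderEmbedding_comp_surjective
    fun z : Σ l, (s l).varFinset => (z.2 : I)
  refine ⟨k, i, fun l => (s l).restrictVar fun z => h ⟨l, z⟩, fun l => ?_⟩
  have hai : ∀ z : (s l).varFinset, (a ∘ i) (h ⟨l, z⟩) = a z := fun z =>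
    congrArg a (congrFun hi ⟨l, z⟩).symm
  exact (Term.realize_restrictVar a hai).trans (hs l)

variable {L' : FirstOrder.Language.{u', v'}} [L'.Structure M]

theorem HasFiniteVCDim.exists_subst (ι : L →ᴸ L') [ι.IsExpansionOn M] {α β γ : Type*}
    {φ : L.Formula (α ⊕ β)} (hφ : HasFiniteVCDim M φ) (t : α → L'.Term γ) :
    ∃ χ : L'.Formula (γ ⊕ β), HasFiniteVCDim M χ ∧ ∀ (x : γ → M) (y : β → M),
      χ.Realize (Sum.elim x y) ↔ φ.Realize (Sum.elim (fun l => (t l).realize x) y) := by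
  let χ : L'.Formula (γ ⊕ β) := (ι.onFormula φ).subst
    (Sum.elim (fun l => (t l).relabel Sum.inl) fun j => Term.var (Sum.inr j))
  have hχ (x : γ → M) (y : β → M) :
      χ.Realize (Sum.elim x y) ↔ φ.Realize (Sum.elim (fun l => (t l).realize x) y) := by
    rw [Formula.Realize, BoundedFormula.realize_subst, ← Formula.Realize, LHom.realize_onFormula]
    refine iff_of_eq (congrArg φ.Realize (funext ?_))
    rintro (l | j) <;> simp [Term.realize_relabel]
  obtain ⟨N, hN⟩ := hφ
  exact ⟨χ, ⟨N, fun a ha => hN _ fun s => (ha s).imp fun b hb i => (hχ _ _).symm.trans (hb i)⟩, hχ⟩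

theorem exists_hasFiniteVCDim_realize_iff (ι : L →ᴸ L') [ι.IsExpansionOn M] {T : L.Theory}
    (hT : TheoryNIP T) [Nonempty M] [M ⊨ T] {I : Type*} [LinearOrder I] {a : I → M} {A : Set M}
    (hA : A ⊆ Substructure.closure L' (Set.range a)) {n : ℕ} (ψ : L[[A]].Formula (Fin n)) :
    ∃ (k : ℕ) (i : Fin k ↪o I) (χ : L'.Formula (Fin k ⊕ Fin n)), HasFiniteVCDim M χ ∧
      ∀ y : Fin n → M, ψ.Realize y ↔ χ.Realize (Sum.elim (a ∘ i) y) := by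
  obtain ⟨m, p, φ, hφ⟩ := exists_formula_realize_iff_of_params ψ
  obtain ⟨k, i, t, ht⟩ := exists_terms_of_mem_closure_range fun l => hA (p l).2
  obtain ⟨χ, hχ, hχφ⟩ := ((hT m n φ).hasFiniteVCDim M).exists_subst ι t
  exact ⟨k, i, χ, hχ, fun y => by rw [hφ, hχφ, funext ht]⟩

end Hull

section Types

variable {L : FirstOrder.Language.{u, v}} {M : Type w} [L.Structure M]

theorem exists_realize_of_completeTheory_model {K : Type*} [L.Structure K]
    [K ⊨ L.completeTheory M] {α β : Type*} [Finite α] [Finite β] {γ : β → L.Formula α}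
    {x : α → K} (hx : ∀ i, (γ i).Realize x) : ∃ y : α → M, ∀ i, (γ i).Realize y := by
  let θ : L.Sentence :=
    Formula.iExs α ((Formula.iInf γ).relabel (Sum.inr : α → Empty ⊕ α))
  have hK : K ⊨ θ := by
    simpa only [θ, Sentence.Realize, Formula.realize_iExs, Formula.realize_relabel,
      Formula.realize_iInf, Sum.elim_comp_inr] using ⟨x, hx⟩
  simpa only [θ, Sentence.Realize, Formula.realize_iExs, Formula.realize_relabel,
    Formula.realize_iInf, Sum.elim_comp_inr] using (realize_iff_of_model_completeTheory M K θ).1 hK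

theorem exists_ultrafilter_of_completeType {α : Type*} [Finite α]
    (p : (L.completeTheory M).CompleteType α) :
    ∃ U : Ultrafilter (α → M), ∀ ψ : L.Formula α,
      ψ.equivSentence ∈ p ↔ ∀ᶠ y in (U : Filter (α → M)), ψ.Realize y := by
  obtain ⟨K, x, rfl⟩ := Theory.exists_modelType_is_realized_in _ p
  choose y hy using fun G : Finset {ψ : L.Formula α // ψ.Realize x} =>
    exists_realize_of_completeTheory_model (M := M) (γ := fun ψ : G => ψ.1.1) fun ψ => ψ.1.2
  let U : Ultrafilter (α → M) := (Ultrafilter.of Filter.atTop).map y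
  have hU (ψ : L.Formula α) (hψ : ψ.Realize x) : ∀ᶠ y in (U : Filter (α → M)), ψ.Realize y :=
    Ultrafilter.of_le Filter.atTop <| (Filter.eventually_ge_atTop {⟨ψ, hψ⟩}).mono fun G hG =>
      hy G ⟨⟨ψ, hψ⟩, hG (Finset.mem_singleton_self _)⟩
  refine ⟨U, fun ψ => Theory.CompleteType.formula_mem_typeOf.trans ⟨hU ψ, fun h => ?_⟩⟩
  by_contra hψ
  exact Ultrafilter.eventually_not.1 (hU ψ.not hψ) h

end Types

section Counting

theorem mk_sigma_nat_le {F : ℕ → Type w} {c : Cardinal.{w}} (hc : ℵ₀ ≤ c) (hF : ∀ n, #(F n) ≤ c) :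
    #(Σ n, F n) ≤ c := by
  calc #(Σ n, F n) = sum fun n => #(F n) := mk_sigma _
    _ ≤ sum fun _ : ℕ => c := sum_le_sum _ _ hF
    _ = ℵ₀ * c := by rw [sum_const, mk_nat, lift_aleph0, lift_uzero]
    _ ≤ c := mul_le_of_le hc hc le_rfl

theorem max_aleph0_power_le {κ c : Cardinal.{w}} (hκ : 2 ≤ κ) (hc : ℵ₀ ≤ c) :
    max ℵ₀ κ ^ c ≤ κ ^ c := by
  rcases le_total ℵ₀ κ with h | h
  · rw [max_eq_right h]
  · rw [max_eq_left h, power_eq_two_power hc ofNat_le_aleph0 hc]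
    exact power_le_power_right hκ

theorem mk_formula_le (L : FirstOrder.Language.{u, v}) (α : Type) [Countable α] :
    #(L.Formula α) ≤ max ℵ₀ L.card := by
  have hinj : Function.Injective (Sigma.mk 0 : L.Formula α → Σ n, L.BoundedFormula α n) :=
    sigma_mk_injective
  refine (mk_le_of_injective hinj).trans (BoundedFormula.card_le.trans ?_)
  refine max_le (le_max_left _ _) (add_le_of_le (le_max_left _ _) ?_ ?_)
  · exact (lift_le_aleph0.2 mk_le_aleph0).trans (le_max_left _ _)
  · rw [lift_uzero]
    exact le_max_right _ _

theorem exists_subset_closure_range {L : FirstOrder.Language.{u, v}} {M J : Type w}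
    [L.Structure M] {a : J → M} {A : Set M} (hA : A ⊆ Substructure.closure L (Set.range a)) :
    ∃ I : Set J, #I ≤ max ℵ₀ #A ∧ A ⊆ Substructure.closure L (Set.range fun i : I => a i) := by
  classical
  choose s hs using fun y : A => mem_closure_range_iff.1 (hA y.2)
  have hI (y : A) : ((s y).varFinset : Set J) ⊆ ⋃ y, (s y).varFinset :=
    Set.subset_iUnion (fun y => ((s y).varFinset : Set J)) y
  refine ⟨⋃ y, (s y).varFinset, ?_, fun y hy => mem_closure_range_iff.2
    ⟨_, (Term.realize_restrictVar' (hI ⟨y, hy⟩)).trans (hs ⟨y, hy⟩)⟩⟩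
  calc #(⋃ y, ((s y).varFinset : Set J)) ≤ sum fun y => #((s y).varFinset : Set J) :=
        mk_iUnion_le_sum_mk
    _ ≤ sum fun _ : A => ℵ₀ := sum_le_sum _ _ fun _ => mk_le_aleph0
    _ = #A * ℵ₀ := sum_const' _ _
    _ ≤ max ℵ₀ #A := mul_le_of_le (le_max_left _ _) (le_max_right _ _) (le_max_left _ _)

variable {L : FirstOrder.Language.{u, v}} {L' : FirstOrder.Language.{max u v, v}} {T : L.Theory}
  {M J : Type (max u v w)} [L.Structure M] [L'.Structure M] [Nonempty M] [M ⊨ T]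
  [LinearOrder J] [WellFoundedLT J]

theorem Indiscernible.comp_strictMono {L : FirstOrder.Language.{u, v}} {M I J : Type*}
    [L.Structure M] [LinearOrder I] [LinearOrder J] {a : J → M} (ha : Indiscernible L a)
    {f : I → J} (hf : StrictMono f) : Indiscernible L (a ∘ f) :=
  fun n φ _ _ hi hj => ha n φ _ _ (hf.comp hi) (hf.comp hj)

/-- A type `p`, given by an ultrafilter, is determined by the traces of the `L'`-formulas of finite
VC dimension, and each of these has at most `max ℵ₀ #J` possible values. -/
theorem mk_typesOver_le (ι : L →ᴸ L') [ι.IsExpansionOn M] (hT : TheoryNIP T) {a : J → M}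
    (ha : Indiscernible L' a) {A : Set M} (hA : A ⊆ Substructure.closure L' (Set.range a))
    (n : ℕ) : #(TypesOver L A n) ≤ max ℵ₀ #J ^ lift.{w} (max ℵ₀ L'.card) := by
  let X := {x : Σ k : ℕ, L'.Formula (Fin k ⊕ Fin n) // HasFiniteVCDim M x.2}
  have hX : #X ≤ max ℵ₀ L'.card := (mk_subtype_le _).trans
    (mk_sigma_nat_le (le_max_left _ _) fun k => mk_formula_le L' _)
  choose U hU using fun p : TypesOver L A n => exists_ultrafilter_of_completeType p
  let traces (p : TypesOver L A n) (x : X) : {S : Set (Fin x.1.1 ↪o J) // IsCutDetermined S} :=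
    ⟨trace a (U p) x.1.2, isCutDetermined_trace ha x.2 (U p)⟩
  have htraces : Function.Injective traces := fun p q hpq => SetLike.ext fun σ => by
    obtain ⟨ψ, rfl⟩ := Formula.equivSentence.surjective σ
    obtain ⟨k, i, χ, hχ, hψ⟩ := exists_hasFiniteVCDim_realize_iff ι hT hA ψ
    have htrace : trace a (U p) χ = trace a (U q) χ :=
      congrArg Subtype.val (congrFun hpq ⟨⟨k, χ⟩, hχ⟩)
    rw [hU, hU]
    simp only [hψ]
    exact Set.ext_iff.1 htrace i
  calc #(TypesOver L A n)
      ≤ #(∀ x : X, {S : Set (Fin x.1.1 ↪o J) // IsCutDetermined S}) := mk_le_of_injective htraces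
    _ = prod fun x : X => #{S : Set (Fin x.1.1 ↪o J) // IsCutDetermined S} := mk_pi _
    _ ≤ prod fun _ : X => max ℵ₀ #J := prod_le_prod _ _ fun _ => mk_isCutDetermined_le
    _ = max ℵ₀ #J ^ lift.{w} #X := by rw [prod_const, lift_id', lift_umax.{max u v, w}]
    _ ≤ max ℵ₀ #J ^ lift.{w} (max ℵ₀ L'.card) :=
        power_le_power_left (aleph0_pos.trans_le (le_max_left _ _)).ne' (lift_le.2 hX)

theorem mk_allTypesOver_le (ι : L →ᴸ L') [ι.IsExpansionOn M] (hT : TheoryNIP T) {a : J → M}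
    (ha : Indiscernible L' a) {A : Set M} (hA : A ⊆ Substructure.closure L' (Set.range a))
    (hA2 : 2 ≤ #A) : #(AllTypesOver L A) ≤ #A ^ lift.{w} (max ℵ₀ L'.card) := by
  have hc : ℵ₀ ≤ lift.{w} (max ℵ₀ L'.card) := aleph0_le_lift.2 (le_max_left _ _)
  obtain ⟨I, hI, hAI⟩ := exists_subset_closure_range hA
  refine mk_sigma_nat_le ((hc.trans (cantor _).le).trans (power_le_power_right hA2)) fun n => ?_
  calc #(TypesOver L A n)
      ≤ max ℵ₀ #I ^ lift.{w} (max ℵ₀ L'.card) :=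
        mk_typesOver_le ι hT (ha.comp_strictMono (Subtype.strictMono_coe I)) hAI n
    _ ≤ max ℵ₀ #A ^ lift.{w} (max ℵ₀ L'.card) :=
        power_le_power_right (max_le (le_max_left _ _) hI)
    _ ≤ #A ^ lift.{w} (max ℵ₀ L'.card) := max_aleph0_power_le hA2 hc

end Counting

section Rank

variable {L : FirstOrder.Language.{u, v}} {N : Type w} {α : Type*} (ρ : ∀ {n}, L.Functions n → ℕ)

/-- The largest rank of a function symbol occurring in a term, where `ρ` assigns ranks to function
symbols. -/
def termRank : L.Term α → ℕ
  | Term.var _ => 0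
  | Term.func f ts => max (ρ f) (Finset.univ.sup fun i => termRank (ts i))

/-- The largest rank of a function symbol occurring in a formula, where `ρ` assigns ranks to
function symbols. -/
def formulaRank : ∀ {n : ℕ}, L.BoundedFormula α n → ℕ
  | _, BoundedFormula.falsum => 0
  | _, BoundedFormula.equal t s => max (termRank ρ t) (termRank ρ s)
  | _, BoundedFormula.rel _ ts => Finset.univ.sup fun i => termRank ρ (ts i)
  | _, BoundedFormula.imp φ ψ => max (formulaRank φ) (formulaRank ψ)
  | _, BoundedFormula.all φ => formulaRank φ

variable {ρ} {S S' : L.Structure N} {r : ℕ}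

theorem realize_term_eq_of_agree
    (hfun : ∀ {n} (f : L.Functions n), ρ f ≤ r → S.funMap f = S'.funMap f)
    {t : L.Term α} (ht : termRank ρ t ≤ r) (v : α → N) :
    @Term.realize L N S α v t = @Term.realize L N S' α v t := by
  induction t with
  | var => rfl
  | func f ts ih =>
    rw [termRank, max_le_iff, Finset.sup_le_iff] at ht
    simp only [Term.realize, hfun f ht.1, ih _ (ht.2 _ (Finset.mem_univ _))]

theorem realize_formula_iff_of_agree
    (hfun : ∀ {n} (f : L.Functions n), ρ f ≤ r → S.funMap f = S'.funMap f)
    (hrel : ∀ {n} (R : L.Relations n), S.RelMap R = S'.RelMap R)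
    {n : ℕ} {φ : L.BoundedFormula α n} (hφ : formulaRank ρ φ ≤ r) (v : α → N) (x : Fin n → N) :
    @BoundedFormula.Realize L N S α n φ v x ↔ @BoundedFormula.Realize L N S' α n φ v x := by
  induction φ with
  | falsum => rfl
  | equal t s =>
    rw [formulaRank, max_le_iff] at hφ
    simp only [BoundedFormula.Realize, realize_term_eq_of_agree hfun hφ.1,
      realize_term_eq_of_agree hfun hφ.2]
  | rel R ts =>
    rw [formulaRank, Finset.sup_le_iff] at hφ
    simp only [BoundedFormula.Realize, hrel R,
      realize_term_eq_of_agree hfun (hφ _ (Finset.mem_univ _))]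
  | imp φ ψ ihφ ihψ =>
    rw [formulaRank, max_le_iff] at hφ
    simp only [BoundedFormula.Realize, ihφ hφ.1, ihψ hφ.2]
  | all φ ih =>
    simp only [BoundedFormula.Realize, ih hφ]

end Rank

section Skolem

variable (L : FirstOrder.Language.{u, v})

/-- A set of names for the formulas of the Skolem language. It is fixed before that language is
defined, by cardinality alone, since the function symbols of the language refer to names of its own
formulas. -/
def SkolemIndex : Type (max u v) := (max ℵ₀ L.card).out

/-- The Skolem function symbols: `(j, x)`, at each arity, stands for the Skolem function of the
formula named `x`, introduced at stage `j`. -/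
def skolemFunctions : FirstOrder.Language.{max u v, 0} :=
  ⟨fun _ => ℕ × SkolemIndex L, fun _ => Empty⟩

/-- The extension of `L` by the Skolem function symbols. -/
abbrev skolemLanguage : FirstOrder.Language.{max u v, v} :=
  L.sum (skolemFunctions L)

theorem card_skolemLanguage_le : (skolemLanguage L).card ≤ max ℵ₀ L.card := by
  have hc : ℵ₀ ≤ max ℵ₀ L.card := le_max_left _ _
  have hfun : #(Σ n, (skolemFunctions L).Functions n) ≤ max ℵ₀ L.card :=
    mk_sigma_nat_le hc fun n => by
      rw [skolemFunctions, mk_prod, mk_nat]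
      simp only [lift_aleph0, lift_uzero, SkolemIndex, mk_out]
      exact mul_le_of_le hc hc le_rfl
  have hskolem : (skolemFunctions L).card ≤ max ℵ₀ L.card := by
    have : IsEmpty (Σ n, (skolemFunctions L).Relations n) := ⟨fun R => R.2.elim⟩
    rw [Language.card, mk_sum, mk_eq_zero (Σ n, (skolemFunctions L).Relations n), lift_zero,
      add_zero, lift_uzero]
    exact hfun
  rw [Language.card_sum, lift_id'.{max u v, max u v}, lift_id'.{max u v, max u v}]
  exact add_le_of_le hc (le_max_right _ _) hskolem

variable {L}

/-- The stage at which a function symbol of the Skolem language is available. -/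
def functionRank {n : ℕ} : (skolemLanguage L).Functions n → ℕ
  | Sum.inl _ => 0
  | Sum.inr p => p.1 + 1

/-- The name of a formula of the Skolem language. -/
noncomputable def skolemCode :
    (Σ n, (skolemLanguage L).Formula (Fin (n + 1))) ↪ SkolemIndex L :=
  Nonempty.some <| by
    have hc : ℵ₀ ≤ max ℵ₀ L.card := le_max_left _ _
    rw [← Cardinal.le_def, SkolemIndex, mk_out]
    exact mk_sigma_nat_le hc fun n =>
      (mk_formula_le _ _).trans (max_le hc (card_skolemLanguage_le L))

/-- The Skolem term `t(x)` of a formula `φ(x, y)`. -/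
noncomputable def skolemTerm {n : ℕ} (φ : (skolemLanguage L).Formula (Fin (n + 1))) :
    (skolemLanguage L).Term (Fin n) :=
  Term.func (Sum.inr (formulaRank functionRank φ, skolemCode ⟨n, φ⟩)) Term.var

/-- The sentence `∀ x y, φ(x, y) → φ(x, t(x))`, where `t` is the Skolem term of `φ`. -/
noncomputable def skolemSentence {n : ℕ} (φ : (skolemLanguage L).Formula (Fin (n + 1))) :
    (skolemLanguage L).Sentence :=
  Formula.iAlls (Fin (n + 1)) (Formula.relabel Sum.inr (φ.imp (φ.subst
    (Fin.snoc (α := fun _ => (skolemLanguage L).Term (Fin (n + 1)))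
      (fun i => Term.var i.castSucc) ((skolemTerm φ).relabel Fin.castSucc)))))

/-- The Skolemization of a theory. -/
def skolemTheory (T : L.Theory) : (skolemLanguage L).Theory :=
  LHom.sumInl.onTheory T ∪
    Set.range fun p : Σ n, (skolemLanguage L).Formula (Fin (n + 1)) => skolemSentence p.2

theorem realize_subst_snoc {L : FirstOrder.Language.{u, v}} {N : Type w} [L.Structure N] {n : ℕ}
    (φ : L.Formula (Fin (n + 1))) (t : L.Term (Fin n)) (x : Fin n → N) (y : N) :
    Formula.Realize (φ.subst (Fin.snoc (α := fun _ => L.Term (Fin (n + 1)))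
      (fun i => Term.var i.castSucc) (t.relabel Fin.castSucc))) (Fin.snoc x y : Fin (n + 1) → N) ↔
      φ.Realize (Fin.snoc x (t.realize x) : Fin (n + 1) → N) := by
  rw [Formula.Realize, BoundedFormula.realize_subst, Formula.Realize, iff_iff_eq]
  congr 1
  funext i
  cases i using Fin.lastCases with
  | last => simp [Function.comp_def]
  | cast i => simp

theorem realize_skolemSentence {N : Type w} [(skolemLanguage L).Structure N] {n : ℕ}
    (φ : (skolemLanguage L).Formula (Fin (n + 1))) :
    N ⊨ skolemSentence φ ↔ ∀ (x : Fin n → N) (y : N), φ.Realize (Fin.snoc x y : Fin (n + 1) → N) →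
      φ.Realize (Fin.snoc x ((skolemTerm φ).realize x) : Fin (n + 1) → N) := by
  rw [skolemSentence, Sentence.Realize, Formula.realize_iAlls]
  simp only [Formula.realize_relabel]
  refine ⟨fun h x y => ?_, fun h z => ?_⟩
  · rw [← realize_subst_snoc φ (skolemTerm φ) x y]
    exact h (Fin.snoc x y)
  · rw [← Fin.snoc_init_self z]
    intro hz
    exact (realize_subst_snoc φ (skolemTerm φ) _ _).2 (h _ _ hz)

variable {N : Type w}

/-- The structure on `N` in which `(j, x)`, at arity `n`, is interpreted by `σ j n x`. -/
abbrev skolemStructure (σ : ℕ → ∀ n, SkolemIndex L → (Fin n → N) → N) :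
    (skolemFunctions L).Structure N :=
  ⟨fun p => σ p.1 _ p.2, fun R => R.elim⟩

variable [L.Structure N]

theorem realize_skolemStructure_congr {σ τ : ℕ → ∀ n, SkolemIndex L → (Fin n → N) → N}
    {n : ℕ} {φ : (skolemLanguage L).Formula (Fin n)}
    (h : ∀ j < formulaRank functionRank φ, σ j = τ j) (v : Fin n → N) :
    (let _ := skolemStructure σ; φ.Realize v) ↔ (let _ := skolemStructure τ; φ.Realize v) := by
  refine realize_formula_iff_of_agree (ρ := functionRank) (fun f hf => ?_) (fun R => ?_) le_rfl v
    default
  · rcases f with f | ⟨j, x⟩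
    · rfl
    · exact congrFun (congrFun (h j hf) _) x
  · rcases R with R | R
    · rfl
    · exact R.elim

variable [Nonempty N]

/-- The choice of a witness `y` for each formula `φ(v, y)`, evaluated with the Skolem functions
interpreted by `σ`. -/
noncomputable def skolemChoice (σ : ℕ → ∀ n, SkolemIndex L → (Fin n → N) → N) (n : ℕ)
    (x : SkolemIndex L) (v : Fin n → N) : N :=
  let _ := skolemStructure σ
  Classical.epsilon fun y => ∃ φ : (skolemLanguage L).Formula (Fin (n + 1)),
    skolemCode ⟨n, φ⟩ = x ∧ φ.Realize (Fin.snoc v y : Fin (n + 1) → N)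

theorem realize_snoc_skolemChoice {σ : ℕ → ∀ n, SkolemIndex L → (Fin n → N) → N} {n : ℕ}
    {φ : (skolemLanguage L).Formula (Fin (n + 1))} {v : Fin n → N} {y : N} :
    let _ := skolemStructure σ
    φ.Realize (Fin.snoc v y : Fin (n + 1) → N) →
      φ.Realize (Fin.snoc v (skolemChoice σ n (skolemCode ⟨n, φ⟩) v) : Fin (n + 1) → N) := by
  intro _ hy
  obtain ⟨ψ, hψ, h⟩ := Classical.epsilon_spec (p := fun y : N =>
    ∃ ψ : (skolemLanguage L).Formula (Fin (n + 1)), skolemCode ⟨n, ψ⟩ = skolemCode ⟨n, φ⟩ ∧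
      ψ.Realize (Fin.snoc v y : Fin (n + 1) → N)) ⟨y, φ, rfl, hy⟩
  obtain rfl : ψ = φ := by simpa using skolemCode.injective hψ
  exact h

variable (L N) in
/-- The interpretation of the Skolem functions, by recursion on the stage: at stage `j` it chooses
witnesses for the formulas whose Skolem functions were introduced before. The value `arbitrary`
for the other Skolem functions does not matter. -/
noncomputable def skolemInterp (j : ℕ) : ∀ n, SkolemIndex L → (Fin n → N) → N :=
  skolemChoice fun i => if i < j then skolemInterp i else fun _ _ _ => Classical.arbitrary N

theorem model_skolemTheory (T : L.Theory) [N ⊨ T] :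
    let _ := skolemStructure (skolemInterp L N)
    N ⊨ skolemTheory T := by
  intro _
  refine Theory.Model.union ((LHom.onTheory_model _ _).2 inferInstance) ?_
  rw [Theory.model_iff, Set.forall_mem_range]
  rintro ⟨n, φ⟩
  rw [realize_skolemSentence]
  intro x y hxy
  let j := formulaRank functionRank φ
  let σ : ℕ → ∀ n, SkolemIndex L → (Fin n → N) → N :=
    fun i => if i < j then skolemInterp L N i else fun _ _ _ => Classical.arbitrary N
  have hσ (z : Fin (n + 1) → N) :
      (let _ := skolemStructure σ; φ.Realize z) ↔ φ.Realize z :=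
    realize_skolemStructure_congr (fun i hi => if_pos hi) z
  have hterm : (skolemTerm φ).realize x = skolemChoice σ n (skolemCode ⟨n, φ⟩) x := by
    change skolemInterp L N j n (skolemCode ⟨n, φ⟩) x = _
    rw [skolemInterp]
  rw [hterm]
  exact (hσ _).1 (realize_snoc_skolemChoice ((hσ _).2 hxy))

end Skolem

theorem isSkolemization_skolemTheory {L : FirstOrder.Language.{u, v}} (T : L.Theory) :
    IsSkolemization.{u, v, w} LHom.sumInl T (skolemTheory T) where
  injective := LHom.sumInl_injective
  card_le := card_skolemLanguage_le L
  extends_theory := Set.subset_union_left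
  expands N :=
    let _ := skolemStructure (skolemInterp L N)
    ⟨inferInstance, inferInstance, model_skolemTheory T⟩
  skolem n φ := ⟨skolemTerm φ, fun K => (realize_skolemSentence φ).1
    (K.is_model.realize_of_mem _ (Or.inr ⟨⟨n, φ⟩, rfl⟩))⟩

section UltrafilterPower

variable {N : Type w}

/-- The `n`-fold product of an ultrafilter with itself. -/
def ultrafilterPower (U : Ultrafilter N) : ∀ n : ℕ, Ultrafilter (Fin n → N)
  | 0 => pure default
  | n + 1 => U.bind fun x => (ultrafilterPower U n).map fun y => (Fin.cons x y : Fin (n + 1) → N)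

theorem eventually_ultrafilterPower_succ {U : Ultrafilter N} {n : ℕ}
    {P : (Fin (n + 1) → N) → Prop} :
    (∀ᶠ z in ultrafilterPower U (n + 1), P z) ↔
      ∀ᶠ x in U, ∀ᶠ y in ultrafilterPower U n, P (Fin.cons x y) :=
  Iff.rfl

theorem exists_strictMono_succ_eq {n r : ℕ} {i : Fin n → Fin (r + 1)} (hi : StrictMono i)
    (h : ∀ l, i l ≠ 0) : ∃ i' : Fin n → Fin r, StrictMono i' ∧ ∀ l, (i' l).succ = i l :=
  ⟨fun l => (i l).pred (h l), fun _ _ hl => Fin.pred_lt_pred_iff.2 (hi hl),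
    fun l => Fin.succ_pred _ (h l)⟩

theorem eventually_ultrafilterPower_comp {U : Ultrafilter N} {n r : ℕ} {i : Fin n → Fin r}
    (hi : StrictMono i) (P : (Fin n → N) → Prop) :
    (∀ᶠ z in ultrafilterPower U r, P (z ∘ i)) ↔ ∀ᶠ y in ultrafilterPower U n, P y := by
  induction r generalizing n with
  | zero =>
    obtain rfl : n = 0 := Nat.eq_zero_of_not_pos fun hn => (i ⟨0, hn⟩).elim0
    simp only [Subsingleton.elim (_ : Fin 0 → N) default]
  | succ r ih =>
    rw [eventually_ultrafilterPower_succ]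
    cases n with
    | zero =>
      have hP (y : Fin 0 → N) : P y ↔ P default := by rw [Subsingleton.elim y default]
      simp only [hP, Filter.eventually_const]
    | succ n =>
      by_cases h0 : i 0 = 0
      · have hne (l : Fin n) : i l.succ ≠ 0 := h0 ▸ (hi (Fin.succ_pos l)).ne'
        obtain ⟨i', hi', hsucc : ∀ l, (i' l).succ = i l.succ⟩ :=
          exists_strictMono_succ_eq (hi.comp Fin.strictMono_succ) hne
        have hcons (x : N) (y : Fin r → N) :
            (Fin.cons x y : Fin (r + 1) → N) ∘ i = Fin.cons x (y ∘ i') := by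
          funext l
          cases l using Fin.cases with
          | zero => simp [h0]
          | succ l => simp [← hsucc l]
        simp only [hcons, eventually_ultrafilterPower_succ]
        exact Filter.eventually_congr (.of_forall fun x => ih hi' fun y => P (Fin.cons x y))
      · have hne (l : Fin (n + 1)) : i l ≠ 0 :=
          ((Fin.pos_iff_ne_zero.2 h0).trans_le (hi.monotone (Fin.zero_le l))).ne'
        obtain ⟨i', hi', hsucc⟩ := exists_strictMono_succ_eq hi hne
        have hcons (x : N) (y : Fin r → N) : (Fin.cons x y : Fin (r + 1) → N) ∘ i = y ∘ i' := by
          funext l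
          simp [← hsucc l]
        simp only [hcons, Filter.eventually_const, ih hi' P]

theorem exists_forall_comp_of_eventually (U : Ultrafilter N) {J : Type*} [LinearOrder J]
    {Q : Type*} [Finite Q] {n : Q → ℕ} {i : ∀ q, Fin (n q) → J} (hi : ∀ q, StrictMono (i q))
    {P : ∀ q, (Fin (n q) → N) → Prop} (hP : ∀ q, ∀ᶠ y in ultrafilterPower U (n q), P q y) :
    ∃ x : J → N, ∀ q, P q (x ∘ i q) := by
  have : Nonempty N := (U.nonempty_of_mem Filter.univ_mem).to_type
  obtain ⟨c, e, h, -, hg⟩ := exists_orderEmbedding_comp_surjective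
    fun p : Σ q, Fin (n q) => i p.1 p.2
  have heh (q : Q) (l : Fin (n q)) : i q l = e (h ⟨q, l⟩) := congrFun hg ⟨q, l⟩
  have hmono (q : Q) : StrictMono fun l => h ⟨q, l⟩ := fun l l' hl => by
    rw [← e.lt_iff_lt, ← heh, ← heh]
    exact hi q hl
  have hz : ∀ᶠ z in ultrafilterPower U c, ∀ q, P q (z ∘ fun l => h ⟨q, l⟩) :=
    Filter.eventually_all.2 fun q => (eventually_ultrafilterPower_comp (hmono q) (P q)).2 (hP q)
  obtain ⟨z, hz⟩ := hz.exists
  refine ⟨Function.extend e z fun _ => Classical.arbitrary N, fun q => ?_⟩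
  have hext : Function.extend e z (fun _ => Classical.arbitrary N) ∘ i q =
      z ∘ fun l => h ⟨q, l⟩ := funext fun l =>
    (congrArg _ (heh q l)).trans (e.injective.extend_apply _ _ _)
  exact hext ▸ hz q

end UltrafilterPower

section Hull

variable {L : FirstOrder.Language.{u, v}}

theorem exists_realize_comp_iff_eventually {N : Type w} [L.Structure N] (U : Ultrafilter N)
    (J : Type w') [LinearOrder J] :
    ∃ (K : Theory.ModelType.{u, v, max u v w'} (L.completeTheory N)) (a : J → K),
      ∀ (n : ℕ) (φ : L.Formula (Fin n)) (i : Fin n → J), StrictMono i →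
        (φ.Realize (a ∘ i) ↔ ∀ᶠ y : Fin n → N in ultrafilterPower U n, φ.Realize y) := by
  have : Nonempty N := (U.nonempty_of_mem Filter.univ_mem).to_type
  let β := {p : Σ n : ℕ, L.Formula (Fin n) × (Fin n → J) //
    StrictMono p.2.2 ∧ ∀ᶠ y : Fin p.1 → N in ultrafilterPower U p.1, p.2.1.Realize y}
  have hfin (G : Finset β) : ∃ (M : Theory.ModelType.{u, v, w} (L.completeTheory N)) (x : J → M),
      ∀ p ∈ G, (p.1.2.1.relabel p.1.2.2).Realize x := by
    obtain ⟨x, hx⟩ := exists_forall_comp_of_eventually U (fun p : G => p.1.2.1)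
      (P := fun p => p.1.1.2.1.Realize) fun p => p.1.2.2
    exact ⟨Theory.ModelType.of _ N, x, fun p hp => Formula.realize_relabel.2 (hx ⟨p, hp⟩)⟩
  obtain ⟨K, a, ha⟩ := exists_realize_of_finitely_realized _ hfin
  have hrealize {n : ℕ} (φ : L.Formula (Fin n)) {i : Fin n → J} (hi : StrictMono i)
      (hφ : ∀ᶠ y : Fin n → N in ultrafilterPower U n, φ.Realize y) : φ.Realize (a ∘ i) :=
    Formula.realize_relabel.1 (ha ⟨⟨n, φ, i⟩, hi, hφ⟩)
  refine ⟨K, a, fun n φ i hi => ⟨fun h => ?_, hrealize φ hi⟩⟩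
  by_contra hφ
  exact hrealize φ.not hi (Ultrafilter.eventually_not.2 hφ) h

theorem exists_injective_indiscernible (L : FirstOrder.Language.{u, v}) (N : Type w)
    [L.Structure N] [Infinite N] (J : Type w') [LinearOrder J] :
    ∃ (K : Theory.ModelType.{u, v, max u v w'} (L.completeTheory N)) (a : J → K),
      Function.Injective a ∧ Indiscernible L a := by
  obtain ⟨K, a, ha⟩ := exists_realize_comp_iff_eventually (L := L) (Filter.hyperfilter N) J
  refine ⟨K, a, .of_lt_imp_ne fun i j hij => ?_,
    fun n φ i j hi hj => (ha n φ i hi).trans (ha n φ j hj).symm⟩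
  have hne : ∀ᶠ y : Fin 2 → N in ultrafilterPower (Filter.hyperfilter N) 2,
      (Formula.not (Term.equal (L := L) (Term.var 0) (Term.var 1))).Realize y := by
    simp only [eventually_ultrafilterPower_succ, Formula.realize_not, Formula.realize_equal,
      Term.realize_var]
    refine .of_forall fun x => ?_
    filter_upwards [(Set.finite_singleton x).compl_mem_hyperfilter] with y hy
    exact .of_forall fun _ h => hy h.symm
  have hmono : StrictMono ![i, j] := by
    simpa using hij
  simpa [Formula.realize_equal] using (ha _ _ _ hmono).2 hne

/-- Every formula `φ(x, y)` has a Skolem term in `K`: a term `t(x)` with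
`K ⊨ ∀ x (∃ y φ(x, y) → φ(x, t(x)))`. -/
def HasSkolemTerms (L : FirstOrder.Language.{u, v}) (K : Type w) [L.Structure K] : Prop :=
  ∀ (n : ℕ) (φ : L.Formula (Fin (n + 1))), ∃ t : L.Term (Fin n), ∀ (x : Fin n → K) (y : K),
    φ.Realize (Fin.snoc x y : Fin (n + 1) → K) →
      φ.Realize (Fin.snoc x (t.realize x) : Fin (n + 1) → K)

theorem HasSkolemTerms.isElementary {K : Type w} [L.Structure K] (hK : HasSkolemTerms L K)
    (S : L.Substructure K) : S.IsElementary := by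
  refine S.isElementary_of_exists fun n φ x y hφ => ?_
  let ψ : L.Formula (Fin (n + 1)) := φ.toFormula.relabel (Sum.elim Empty.elim id)
  have hψ (z : Fin (n + 1) → K) : ψ.Realize z ↔ φ.Realize default z := by
    rw [Formula.realize_relabel, BoundedFormula.realize_toFormula]
    exact iff_of_eq (congrArg₂ _ (Subsingleton.elim _ _) rfl)
  obtain ⟨t, ht⟩ := hK n ψ
  exact ⟨⟨t.realize fun l => (x l : K), t.realize_mem _ fun i => (x i).2⟩,
    (hψ _).1 (ht _ y ((hψ _).2 hφ))⟩

theorem closure_range_codRestrict_eq_top {K J : Type*} [L.Structure K] (a : J → K) :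
    Substructure.closure L (Set.range fun j =>
      (⟨a j, Substructure.subset_closure ⟨j, rfl⟩⟩ : Substructure.closure L (Set.range a))) =
        ⊤ := by
  let S := Substructure.closure L (Set.range a)
  refine Substructure.map_injective_of_injective (f := S.subtype.toHom) Subtype.val_injective ?_
  rw [Substructure.map_closure, ← Set.range_comp, ← Hom.range_eq_map]
  exact S.range_subtype.symm

theorem exists_model_closure_range_eq_top {T : L.Theory}
    (hT : ∀ K : Theory.ModelType.{u, v, max u v w'} T, HasSkolemTerms L K)
    (N : Type w) [L.Structure N] [N ⊨ T] [Infinite N] (J : Type w') [LinearOrder J] :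
    ∃ (M : Theory.ModelType.{u, v, max u v w'} T) (a : J → M), Function.Injective a ∧
      Indiscernible L a ∧ Substructure.closure L (Set.range a) = ⊤ := by
  obtain ⟨K, a, hinj, ha⟩ := exists_injective_indiscernible L N J
  have hKT : K ⊨ T := K.is_model.mono Theory.completeTheory.subset
  let S : L.ElementarySubstructure K :=
    ⟨Substructure.closure L (Set.range a), (hT (Theory.ModelType.of T K)).isElementary _⟩
  have : S ⊨ T := (S.theory_model_iff T).2 hKT
  let b (j : J) : S := ⟨a j, Substructure.subset_closure ⟨j, rfl⟩⟩
  have hb {n : ℕ} (φ : L.Formula (Fin n)) (i : Fin n → J) :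
      φ.Realize (b ∘ i) ↔ φ.Realize (a ∘ i) := (S.subtype.map_formula φ (b ∘ i)).symm
  refine ⟨Theory.ModelType.of T S, b, fun i j h => hinj (congrArg Subtype.val h),
    fun n φ i j hi hj => ?_, closure_range_codRestrict_eq_top a⟩
  exact (hb φ i).trans ((ha n φ i j hi hj).trans (hb φ j).symm)

theorem mk_eq_of_closure_range_eq_top {M J : Type (max u v w)} [L.Structure M] {a : J → M}
    (hinj : Function.Injective a) (ha : Substructure.closure L (Set.range a) = ⊤)
    (hJ : lift.{w} (max ℵ₀ L.card) ≤ #J) : #M = #J := by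
  refine (mk_le_of_injective hinj).antisymm' ?_
  have hJ0 : ℵ₀ ≤ #J := (aleph0_le_lift.2 (le_max_left _ _)).trans hJ
  have hfun : lift.{max v w} #(Σ n, L.Functions n) ≤ lift.{w} L.card := by
    rw [Language.card, mk_sum, lift_add, lift_lift]
    exact self_le_add_right _ _
  calc #M = #(Substructure.closure L (Set.range a)) := by
        rw [ha, ← SetLike.coe_sort_coe, Substructure.coe_top, mk_univ]
    _ ≤ max ℵ₀ (#(Set.range a) + lift.{max v w} #(Σ n, L.Functions n)) := by
        have h := Substructure.lift_card_closure_le (L := L) (s := Set.range a)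
        rwa [lift_id'.{u, max u v w}, lift_id'.{u, max u v w}, lift_umax.{u, max v w}] at h
    _ ≤ #J := max_le hJ0 (add_le_of_le hJ0 mk_range_le
        (hfun.trans ((lift_le.2 (le_max_right _ _)).trans hJ)))

end Hull

end NIPFewTypes

open NIPFewTypes FirstOrder.Language Cardinal in
theorem mainTheorem11_general {L : FirstOrder.Language.{u, v}} (T : L.Theory)
    (hinf : ∃ N : Theory.ModelType.{u, v, max u v} T, Infinite N) (hNIP : TheoryNIP T)
    (κ : Cardinal.{max u v w}) (hκ : lift.{w, max u v} (theoryCard T) ≤ κ) :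
    ∃ M : Theory.ModelType.{u, v, max u v w} T,
      #M = κ ∧
      (∀ A : Set M, 2 ≤ #A → #(AllTypesOver L A) ≤ #A ^ lift.{w, max u v} (theoryCard T)) ∧
      IsSkolemHullOfIndiscernible T M κ := by
  obtain ⟨N, hN⟩ := hinf
  have hT := isSkolemization_skolemTheory.{u, v, max u v w} T
  obtain ⟨_, -, hNT⟩ := (isSkolemization_skolemTheory T).expands N
  have hc : max ℵ₀ (skolemLanguage L).card ≤ theoryCard T := max_le (le_max_left _ _) hT.card_le
  obtain ⟨M, a, hinj, ha, hgen⟩ := exists_model_closure_range_eq_top (T := skolemTheory T)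
    (fun K n φ => (hT.skolem n φ).imp fun t ht => ht K) N κ.ord.ToType
  let _ : L.Structure M := (LHom.sumInl : L →ᴸ skolemLanguage L).reduct M
  have hexp : (LHom.sumInl : L →ᴸ skolemLanguage L).IsExpansionOn M := LHom.isExpansionOn_reduct _ _
  have hMT : M ⊨ T := (LHom.onTheory_model LHom.sumInl T).1 (M.is_model.mono hT.extends_theory)
  refine ⟨Theory.ModelType.of T M, ?_, fun A hA => ?_,
    skolemLanguage L, LHom.sumInl, skolemTheory T, hT, M.struc, hexp, M.is_model, a, hinj, ha, hgen⟩
  · rw [← mk_ord_toType κ]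
    exact mk_eq_of_closure_range_eq_top (M := M) hinj hgen
      (((lift_le.2 hc).trans hκ).trans_eq (mk_ord_toType κ).symm)
  · exact (mk_allTypesOver_le LHom.sumInl hNIP ha (hgen ▸ Set.subset_univ A) hA).trans
      (power_le_power_left (two_pos.trans_le hA).ne' (lift_le.2 hc))

theorem mainTheorem11 {L : FirstOrder.Language.{u, v}} (T : L.Theory)
    (hcomplete : T.IsComplete)
    (hinf : ∃ N : FirstOrder.Language.Theory.ModelType.{u, v, max u v} T, Infinite N)
    (hNIP : NIPFewTypes.TheoryNIP T)
    (κ : Cardinal.{max u v w})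
    (hκ : Cardinal.lift.{w, max u v} (NIPFewTypes.theoryCard T) ≤ κ) :
    ∃ M : FirstOrder.Language.Theory.ModelType.{u, v, max u v w} T,
      Cardinal.mk M = κ ∧
      (∀ A : Set M, 2 ≤ Cardinal.mk A →
        Cardinal.mk (NIPFewTypes.AllTypesOver L A) ≤
          Cardinal.mk A ^ Cardinal.lift.{w, max u v} (NIPFewTypes.theoryCard T)) ∧
      NIPFewTypes.IsSkolemHullOfIndiscernible T M κ :=
  mainTheorem11_general T hinf hNIP κ hκ
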